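/- **Theorem 4.1.** Let $a_+,a_-\in\mathbb C$ with $\mathrm{Re}\,a_+>0$ and $\mathrm{Re}\,a_->0$, and put $a=(a_++a_-)/2$, $q_\pm=e^{-\pi a_\pm}$. For $\delta\in\{+,-\}$ let $-\delta$ denote the opposite sign and define $$R_\delta(z)=\prod_{k=1}^\infty\bigl(1-q_\delta^{2k-1}e^{2\pi i z}\bigr)\bigl(1-q_\delta^{2k-1}e^{-2\pi i z}\bigr),\qquad G(z)=\prod_{m,n=1}^\infty\frac{1-q_+^{2m-1}q_-^{2n-1}e^{-2\pi i z}}{1-q_+^{2m-1}q_-^{2n-1}e^{2\pi i z}}$$ ($G$ is the elliptic gamma function). For $l\in\mathbb C^4$ let $$f_\delta(l;z)=\frac{\prod_{n=1}^4R_\delta(z+l_n+ia_{-\delta}/4)}{R_\delta(2z-ia_\delta/2)}$$ and let $A_{R,\delta}(l;z)$ be the analytic difference operator acting on functions $F$ by $$(A_{R,\delta}(l;z)F)(z)=f_\delta(l;z)\,F(z+ia_{-\delta}/2)+f_\delta(l;-z)\,F(z-ia_{-\delta}/2).$$ For $\gamma\in\mathbb C$ let $$K(\gamma;z,y)=G(z+y-\gamma)\,G(z-y-\gamma)\,G(-z+y-\gamma)\,G(-z-y-\gamma).$$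 Let $\gamma\in\mathbb C$ and $l\in\mathbb C^4$ satisfy $$\exp(4\pi i\gamma)=\exp\Bigl(2\pi i\Bigl(\sum_{n=1}^4l_n+2ia\Bigr)\Bigr),$$ and define $k\in\mathbb C^4$ by $k_n=-l_n+\gamma-ia$ for $n=1,2,3,4$. Then for both choices $\delta=+,-$, $$A_{R,\delta}(l;z)K(\gamma;z,y)=A_{R,\delta}(k;y)K(\gamma;z,y)$$ as an identity of meromorphic functions of $(z,y)\in\mathbb C^2$. That is, it holds at every $(z,y)$ such that $2z,2y\notin\mathbb Z+ia_\delta\mathbb Z$ and such that none of the factors $G$ of $K(\gamma;z\pm ia_{-\delta}/2,y)$ and $K(\gamma;z,y\pm ia_{-\delta}/2)$ has a pole there, the poles of $G$ being the points $j-i\bigl((m+\tfrac12)a_++(n+\tfrac12)a_-\bigr)$ with $j\in\mathbb Z$ and integers $m,n\ge0$. -/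

import Mathlib

/-!
The two parameters `a_+`, `a_-` are given as one function `a : ℤˣ → ℂ`, with `a 1 = a_+` and
`a (-1) = a_-`. A sign is an element `δ : ℤˣ`, so that `a δ` is `a_δ` and `a (-δ)` is `a_{-δ}`.
-/

noncomputable section

namespace Sklyanin

/-- The nomes `q_δ = exp (-π a_δ)`. -/
def q (a : ℤˣ → ℂ) (δ : ℤˣ) : ℂ := Complex.exp (-(Real.pi * a δ))

/-- The parameter `(a_+ + a_-) / 2`. -/
def halfSum (a : ℤˣ → ℂ) : ℂ := (a 1 + a (-1)) / 2

/-- The elliptic gamma function (with real period `1`)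
`G(z) = ∏_{m,n ≥ 1} (1 - q_+^{2m-1} q_-^{2n-1} e^{-2πiz}) / (1 - q_+^{2m-1} q_-^{2n-1} e^{2πiz})`,
as a quotient of two entire functions without common zeros. -/
def ellGamma (a : ℤˣ → ℂ) (z : ℂ) : ℂ :=
  (∏' p : ℕ × ℕ, (1 - q a 1 ^ (2 * p.1 + 1) * q a (-1) ^ (2 * p.2 + 1) *
      Complex.exp (-(2 * Real.pi * Complex.I * z)))) /
  (∏' p : ℕ × ℕ, (1 - q a 1 ^ (2 * p.1 + 1) * q a (-1) ^ (2 * p.2 + 1) *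
      Complex.exp (2 * Real.pi * Complex.I * z)))

/-- The point `z` is a pole of the elliptic gamma function:
`q_+^{2m+1} q_-^{2n+1} e^{2πiz} = 1` for some `m, n ≥ 0`, that is,
`z ≡ -i ((m + 1/2) a_+ + (n + 1/2) a_-)` modulo `1`. -/
def IsGammaPole (a : ℤˣ → ℂ) (z : ℂ) : Prop :=
  ∃ (m n : ℕ) (k : ℤ), z = k - Complex.I * ((m + 1 / 2) * a 1 + (n + 1 / 2) * a (-1))

/-- `R_δ(z) = ∏_{k ≥ 1} (1 - q_δ^{2k-1} e^{2πiz}) (1 - q_δ^{2k-1} e^{-2πiz})`. -/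
def R (a : ℤˣ → ℂ) (δ : ℤˣ) (z : ℂ) : ℂ :=
  ∏' k : ℕ, ((1 - q a δ ^ (2 * k + 1) * Complex.exp (2 * Real.pi * Complex.I * z)) *
    (1 - q a δ ^ (2 * k + 1) * Complex.exp (-(2 * Real.pi * Complex.I * z))))

/-- The coefficient `f_δ(l;z) = ∏_n R_δ(z + l_n + i a_{-δ}/4) / R_δ(2z - i a_δ/2)`. -/
def coeff (a : ℤˣ → ℂ) (δ : ℤˣ) (l : Fin 4 → ℂ) (z : ℂ) : ℂ :=
  (∏ n, R a δ (z + l n + Complex.I * a (-δ) / 4)) / R a δ (2 * z - Complex.I * a δ / 2)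

/-- The analytic difference operator
`A_{R,δ}(l;z) = f_δ(l;z) exp (i a_{-δ} ∂_z / 2) + (z → -z)`, where `exp (c ∂_z)` is the
translation `F(z) ↦ F(z + c)`. -/
def opAR (a : ℤˣ → ℂ) (δ : ℤˣ) (l : Fin 4 → ℂ) (F : ℂ → ℂ) (z : ℂ) : ℂ :=
  coeff a δ l z * F (z + Complex.I * a (-δ) / 2) +
    coeff a δ l (-z) * F (z - Complex.I * a (-δ) / 2)

/-- The kernel function `K(γ;z,y) = G(±z ± y - γ)`, a product over the four sign choices. -/
def kernelK (a : ℤˣ → ℂ) (γ z y : ℂ) : ℂ :=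
  ellGamma a (z + y - γ) * ellGamma a (z - y - γ) *
    ellGamma a (-z + y - γ) * ellGamma a (-z - y - γ)

/-- None of the four factors of `K(γ;·,·)` has a pole at `(z,y)`. -/
def KernelRegular (a : ℤˣ → ℂ) (γ z y : ℂ) : Prop :=
  ¬ IsGammaPole a (z + y - γ) ∧ ¬ IsGammaPole a (z - y - γ) ∧
    ¬ IsGammaPole a (-z + y - γ) ∧ ¬ IsGammaPole a (-z - y - γ)

/-- The elliptic lattice `Λ_δ = ℤ + i a_δ ℤ`. -/
def lattice (a : ℤˣ → ℂ) (δ : ℤˣ) : Set ℂ :=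
  {w | ∃ m n : ℤ, w = m + n * (Complex.I * a δ)}

end Sklyanin

end

/-! Write b = i a_{-δ}/2. The gamma function satisfies G(u + b) = R_δ(u) G(u - b) (`ellGamma_add`).
A shift of z or y by ±b raises two of the four arguments ±z ± y - γ by b and lowers the other two.
Hence all four terms of the claim contain the product of the four G(±z ± y - γ - b), and what
remains is an identity between the R_δ alone (`coeff_identity`).

By Jacobi's triple product, R_δ(x - τ/2) with τ = i a_δ is a constant times e^{πix} S(x), where S is
an odd theta function (`exists_R_eq_oddTheta`). The constraint on γ makes the exponentials agree in
all terms, so that only an identity for S is left.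

That identity (`kernel_identity`) is algebraic. It uses only that S is odd and continuous, is
nonzero on a dense set, and satisfies S(x + y) S(x - y) = [x, y] := A(x)B(y) - B(x)A(y)
(`exists_oddTheta_mul`). Products of paired factors are then two by two determinants, and the
identity follows from Plücker relations between them. -/

noncomputable section

namespace Sklyanin

open Finset Filter Topology Complex

/-! ### Jacobi's triple product from its finite form. -/

/-- The `q`-Pochhammer symbol `(Q; Q)_n`. -/
def qPoch (Q : ℂ) (n : ℕ) : ℂ := ∏ k ∈ range n, (1 - Q ^ (k + 1))

/-- The reciprocal `1 / (Q; Q)_m`, extended by zero to negative `m`. -/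
def invQPoch (Q : ℂ) : ℤ → ℂ
  | .ofNat n => (qPoch Q n)⁻¹
  | .negSucc _ => 0

lemma one_sub_pow_ne_zero {Q : ℂ} (hQ : ‖Q‖ < 1) (n : ℕ) : 1 - Q ^ (n + 1) ≠ 0 := by
  intro h
  have h1 : ‖Q ^ (n + 1)‖ < 1 := by
    rw [norm_pow]
    exact pow_lt_one₀ (norm_nonneg _) hQ (by omega)
  rw [← sub_eq_zero.1 h] at h1
  simp at h1

lemma invQPoch_of_neg {Q : ℂ} {m : ℤ} (hm : m < 0) : invQPoch Q m = 0 := by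
  obtain ⟨n, rfl⟩ := Int.eq_negSucc_of_lt_zero hm
  rfl

/-- At m = 0 both sides vanish, the right one through 1 - Q^0. The extension by zero thus makes the
recurrence valid on all of ℤ and spares boundary cases below. -/
lemma invQPoch_sub_one {Q : ℂ} (hQ : ‖Q‖ < 1) (m : ℤ) :
    invQPoch Q (m - 1) = (1 - Q ^ m) * invQPoch Q m := by
  rcases m with (_ | n) | n
  · rw [invQPoch_of_neg (by simp)]
    simp
  · have h1 : (Int.ofNat (n + 1) - 1) = Int.ofNat n := by simp
    have h2 := one_sub_pow_ne_zero hQ n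
    rw [h1]
    simp only [invQPoch, qPoch, prod_range_succ, Int.ofNat_eq_natCast, zpow_natCast]
    field_simp
  · rw [show Int.negSucc n - 1 = Int.negSucc (n + 1) by simp [Int.negSucc_eq]; ring]
    simp [invQPoch]

lemma tendsto_qPoch {Q : ℂ} (hQ : ‖Q‖ < 1) :
    ∃ L : ℂ, L ≠ 0 ∧ Tendsto (qPoch Q) atTop (𝓝 L) := by
  have hs : Summable fun k : ℕ => ‖-Q ^ (k + 1)‖ := by
    simp only [norm_neg, norm_pow]
    exact (summable_nat_add_iff 1).2 (summable_geometric_of_lt_one (norm_nonneg _) hQ)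
  refine ⟨∏' k : ℕ, (1 + -Q ^ (k + 1)), ?_, ?_⟩
  · refine tprod_one_add_ne_zero_of_summable (fun k => ?_) hs
    rw [← sub_eq_add_neg]
    exact one_sub_pow_ne_zero hQ k
  · have := (multipliable_one_add_of_summable hs).hasProd.tendsto_prod_nat
    simp only [← sub_eq_add_neg] at this ⊢
    exact this

/-- The central coefficient `(Q;Q)_{2N} / ((Q;Q)_{N+n} (Q;Q)_{N-n})`. -/
def centralQBinom (Q : ℂ) (N : ℕ) (n : ℤ) : ℂ :=
  qPoch Q (2 * N) * invQPoch Q (N + n) * invQPoch Q (N - n)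

lemma tendsto_toNat_atTop : Tendsto Int.toNat atTop atTop :=
  tendsto_atTop.2 fun n => (eventually_ge_atTop (n : ℤ)).mono fun m hm => by omega

lemma tendsto_invQPoch {Q : ℂ} {L : ℂ} (hL : L ≠ 0)
    (h : Tendsto (qPoch Q) atTop (𝓝 L)) : Tendsto (invQPoch Q) atTop (𝓝 L⁻¹) := by
  refine ((h.inv₀ hL).comp tendsto_toNat_atTop).congr' ?_
  filter_upwards [eventually_ge_atTop 0] with m hm
  obtain ⟨n, rfl⟩ := Int.eq_ofNat_of_zero_le hm
  rfl

lemma exists_tendsto_centralQBinom {Q : ℂ} (hQ : ‖Q‖ < 1) :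
    ∃ C : ℂ, C ≠ 0 ∧ ∀ n, Tendsto (fun N => centralQBinom Q N n) atTop (𝓝 C) := by
  obtain ⟨L, hL, h⟩ := tendsto_qPoch hQ
  have hi := tendsto_invQPoch hL h
  refine ⟨L * L⁻¹ * L⁻¹, by simp [hL], fun n => ?_⟩
  refine ((h.comp (tendsto_id.const_mul_atTop' two_pos)).mul (hi.comp ?_)).mul (hi.comp ?_)
  · exact tendsto_atTop_add_const_right _ _ tendsto_natCast_atTop_atTop
  · exact tendsto_atTop_add_const_right _ _ tendsto_natCast_atTop_atTop

/-- Uniformity in both N and n provides the dominating series for the limit in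
`exists_tripleProduct`. -/
lemma exists_centralQBinom_bound {Q : ℂ} (hQ : ‖Q‖ < 1) :
    ∃ M : ℝ, ∀ N n, ‖centralQBinom Q N n‖ ≤ M := by
  obtain ⟨L, hL, h⟩ := tendsto_qPoch hQ
  obtain ⟨M, hM⟩ := (Metric.isBounded_range_of_tendsto _ h).exists_norm_le
  obtain ⟨K, hK⟩ := (Metric.isBounded_range_of_tendsto _ (h.inv₀ hL)).exists_norm_le
  have hK0 : 0 ≤ K := (norm_nonneg _).trans (hK _ ⟨0, rfl⟩)
  have hw : ∀ m, ‖invQPoch Q m‖ ≤ K := by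
    rintro (n | n)
    · exact hK _ ⟨n, rfl⟩
    · simpa [invQPoch] using hK0
  refine ⟨M * K * K, fun N n => ?_⟩
  rw [centralQBinom, norm_mul, norm_mul]
  have hM0 : 0 ≤ M := (norm_nonneg _).trans (hM _ ⟨0, rfl⟩)
  gcongr
  · exact hM _ ⟨_, rfl⟩
  · exact hw _
  · exact hw _

lemma qPoch_two_mul_succ (Q : ℂ) (N : ℕ) :
    qPoch Q (2 * (N + 1)) = qPoch Q (2 * N) * (1 - Q ^ (2 * N + 1)) * (1 - Q ^ (2 * N + 2)) := by
  rw [show 2 * (N + 1) = 2 * N + 1 + 1 by ring, qPoch, prod_range_succ, prod_range_succ]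
  rfl

/-- A two-step q-Pascal rule, shaped to match multiplication by (1 - q^(2N+1) X)(1 - q^(2N+1) X⁻¹).
The powers q^(1-2n) and q^(2n+1) are those relating neighbouring theta terms. Once every reciprocal
is expressed through the indices N + n + 1 and N - n + 1, it is a rational identity in q, q^N and
q^n. -/
lemma centralQBinom_succ {q : ℂ} (hq : ‖q‖ < 1) (hq0 : q ≠ 0) (N : ℕ) (n : ℤ) :
    centralQBinom (q ^ 2) (N + 1) n = (1 + q ^ (4 * N + 2)) * centralQBinom (q ^ 2) N n +
      q ^ (2 * N + 1) * (q ^ (1 - 2 * n) * centralQBinom (q ^ 2) N (n - 1) +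
        q ^ (2 * n + 1) * centralQBinom (q ^ 2) N (n + 1)) := by
  have hQ : ‖q ^ 2‖ < 1 := by
    rw [norm_pow]
    exact pow_lt_one₀ (norm_nonneg _) hq two_ne_zero
  have key := invQPoch_sub_one hQ
  set W := invQPoch (q ^ 2) with hW
  have e1 : W (N + n) = (1 - (q ^ 2) ^ ((N : ℤ) + n + 1)) * W (N + n + 1) := by
    rw [← key]; congr 1; ring
  have e2 : W (N - n) = (1 - (q ^ 2) ^ ((N : ℤ) - n + 1)) * W (N - n + 1) := by
    rw [← key]; congr 1; ring
  have e3 : W (N + n - 1) = (1 - (q ^ 2) ^ ((N : ℤ) + n)) * W (N + n) := key _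
  have e4 : W (N - n - 1) = (1 - (q ^ 2) ^ ((N : ℤ) - n)) * W (N - n) := key _
  simp only [centralQBinom, ← hW, qPoch_two_mul_succ]
  rw [show ((N + 1 : ℕ) : ℤ) + n = N + n + 1 by push_cast; ring,
    show ((N + 1 : ℕ) : ℤ) - n = N - n + 1 by push_cast; ring,
    show (N : ℤ) + (n - 1) = N + n - 1 by ring, show (N : ℤ) - (n - 1) = N - n + 1 by ring,
    show (N : ℤ) + (n + 1) = N + n + 1 by ring, show (N : ℤ) - (n + 1) = N - n - 1 by ring,
    e3, e4, e1, e2]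
  have hB : q ^ n ≠ 0 := zpow_ne_zero _ hq0
  have hz : ∀ m : ℤ, (q ^ 2) ^ m = (q ^ m) ^ 2 := fun m => by
    rw [← zpow_natCast, ← zpow_natCast, zpow_comm]
  simp only [hz, zpow_add₀ hq0, zpow_sub₀ hq0, zpow_natCast, zpow_one, zpow_mul, zpow_two,
    mul_comm (2 : ℤ), pow_add, pow_mul, pow_one, mul_comm 2 N, mul_comm 4 N]
  have h2 : q ^ (n * 2) = (q ^ n) ^ 2 := by rw [zpow_mul]; rfl
  generalize W (N + n + 1) = w1
  generalize W (N - n + 1) = w2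
  generalize q ^ n = B at *
  field_simp
  ring

lemma jacobiTheta₂_term_sub_one (n : ℤ) (z τ : ℂ) :
    jacobiTheta₂_term n (z + 1 / 2) τ =
      -(exp (Real.pi * I * τ) ^ (2 * n - 1) * exp (2 * Real.pi * I * z) *
        jacobiTheta₂_term (n - 1) (z + 1 / 2) τ) := by
  rw [jacobiTheta₂_term, jacobiTheta₂_term, ← exp_int_mul, ← exp_add, ← exp_add, neg_eq_neg_one_mul,
    ← exp_pi_mul_I, ← exp_add]
  congr 1
  push_cast
  ring

lemma jacobiTheta₂_term_add_one (n : ℤ) (z τ : ℂ) :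
    jacobiTheta₂_term n (z + 1 / 2) τ =
      -(exp (Real.pi * I * τ) ^ (-(2 * n + 1)) * exp (-(2 * Real.pi * I * z)) *
        jacobiTheta₂_term (n + 1) (z + 1 / 2) τ) := by
  rw [jacobiTheta₂_term, jacobiTheta₂_term, ← exp_int_mul, ← exp_add, ← exp_add, ← neg_one_mul,
    ← exp_neg_pi_mul_I, ← exp_add]
  congr 1
  push_cast
  ring

lemma norm_nome_lt_one {τ : ℂ} (hτ : 0 < τ.im) : ‖exp (Real.pi * I * τ)‖ < 1 := by
  rw [norm_exp]
  simp [Real.pi_pos, hτ]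

/-- The finite form of Jacobi's triple product identity. -/
lemma hasSum_finite_tripleProduct {τ : ℂ} (hτ : 0 < τ.im) (z : ℂ) (N : ℕ) :
    HasSum (fun n : ℤ => centralQBinom (exp (Real.pi * I * τ) ^ 2) N n *
        jacobiTheta₂_term n (z + 1 / 2) τ)
      (∏ k ∈ range N, ((1 - exp (Real.pi * I * τ) ^ (2 * k + 1) * exp (2 * Real.pi * I * z)) *
        (1 - exp (Real.pi * I * τ) ^ (2 * k + 1) * exp (-(2 * Real.pi * I * z))))) := by
  have hq := norm_nome_lt_one hτ
  have hT1 := fun n => jacobiTheta₂_term_sub_one n z τ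
  have hT2 := fun n => jacobiTheta₂_term_add_one n z τ
  have hX : exp (2 * Real.pi * I * z) * exp (-(2 * Real.pi * I * z)) = 1 := by
    rw [← exp_add, add_neg_cancel, exp_zero]
  have hq0 : exp (Real.pi * I * τ) ≠ 0 := exp_ne_zero _
  set q := exp (Real.pi * I * τ)
  set X := exp (2 * Real.pi * I * z)
  set Y := exp (-(2 * Real.pi * I * z))
  set T := fun n : ℤ => jacobiTheta₂_term n (z + 1 / 2) τ with hT
  change HasSum (fun n => centralQBinom (q ^ 2) N n * T n) _
  change ∀ n, T n = -(q ^ (2 * n - 1) * X * T (n - 1)) at hT1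
  change ∀ n, T n = -(q ^ (-(2 * n + 1)) * Y * T (n + 1)) at hT2
  induction N with
  | zero =>
    have h0 : T 0 = 1 := by simp [hT, jacobiTheta₂_term]
    convert hasSum_single (f := fun n => centralQBinom (q ^ 2) 0 n * T n) 0 ?_ using 1
    · simp [h0, centralQBinom, qPoch, invQPoch]
    · intro n hn
      rcases lt_or_gt_of_ne hn with h | h
      · rw [centralQBinom, invQPoch_of_neg (m := (0 : ℕ) + n) (by simpa using h)]
        simp
      · rw [centralQBinom, invQPoch_of_neg (m := (0 : ℕ) - n) (by simpa using h)]
        simp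
  | succ N ih =>
    -- Since X Y = 1, the new factor is 1 + q^(4N+2) - q^(2N+1) X - q^(2N+1) Y. The X part is summed
    -- with index n - 1 and the Y part with n + 1, so that `a1` and `a2` turn both into multiples of
    -- T n.
    have h1 := ((Equiv.subRight (1 : ℤ)).hasSum_iff.2 ih)
    have h2 := ((Equiv.addRight (1 : ℤ)).hasSum_iff.2 ih)
    have h3 := ((ih.mul_left (1 + q ^ (4 * N + 2))).sub (h1.mul_left (q ^ (2 * N + 1) * X))).sub
      (h2.mul_left (q ^ (2 * N + 1) * Y))
    have hf : ∀ n, centralQBinom (q ^ 2) (N + 1) n * T n =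
        (1 + q ^ (4 * N + 2)) * (centralQBinom (q ^ 2) N n * T n) -
          q ^ (2 * N + 1) * X * (centralQBinom (q ^ 2) N (n - 1) * T (n - 1)) -
          q ^ (2 * N + 1) * Y * (centralQBinom (q ^ 2) N (n + 1) * T (n + 1)) := fun n => by
      rw [centralQBinom_succ hq hq0]
      have a1 : q ^ (1 - 2 * n) * T n = -(X * T (n - 1)) := by
        rw [hT1, show (1 - 2 * n) = -(2 * n - 1) by ring, zpow_neg]
        have := zpow_ne_zero (2 * n - 1) hq0
        field_simp
      have a2 : q ^ (2 * n + 1) * T n = -(Y * T (n + 1)) := by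
        rw [hT2, zpow_neg]
        have := zpow_ne_zero (2 * n + 1) hq0
        field_simp
      linear_combination q ^ (2 * N + 1) * centralQBinom (q ^ 2) N (n - 1) * a1 +
        q ^ (2 * N + 1) * centralQBinom (q ^ 2) N (n + 1) * a2
    rw [funext hf]
    refine Eq.subst (motive := fun s => HasSum _ s) ?_ h3
    rw [prod_range_succ, show 4 * N + 2 = (2 * N + 1) + (2 * N + 1) by ring, pow_add]
    linear_combination (-∏ k ∈ range N, ((1 - q ^ (2 * k + 1) * X) * (1 - q ^ (2 * k + 1) * Y))) *
        q ^ (2 * N + 1) * q ^ (2 * N + 1) * hX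

/-- Jacobi's triple product identity, up to the value of the constant. -/
lemma exists_tripleProduct {τ : ℂ} (hτ : 0 < τ.im) :
    ∃ C : ℂ, C ≠ 0 ∧ ∀ z, Tendsto (fun N => ∏ k ∈ range N,
      ((1 - exp (Real.pi * I * τ) ^ (2 * k + 1) * exp (2 * Real.pi * I * z)) *
        (1 - exp (Real.pi * I * τ) ^ (2 * k + 1) * exp (-(2 * Real.pi * I * z))))) atTop
      (𝓝 (C * jacobiTheta₂ (z + 1 / 2) τ)) := by
  have hQ : ‖exp (Real.pi * I * τ) ^ 2‖ < 1 := by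
    rw [norm_pow]
    exact pow_lt_one₀ (norm_nonneg _) (norm_nome_lt_one hτ) two_ne_zero
  obtain ⟨C, hC0, hC⟩ := exists_tendsto_centralQBinom hQ
  obtain ⟨M, hM⟩ := exists_centralQBinom_bound hQ
  refine ⟨C, hC0, fun z => ?_⟩
  have hs := ((summable_jacobiTheta₂_term_iff (z + 1 / 2) τ).2 hτ).norm.mul_left M
  have := tendsto_tsum_of_dominated_convergence (𝓕 := atTop)
    (f := fun (N : ℕ) (n : ℤ) => centralQBinom (exp (Real.pi * I * τ) ^ 2) N n *
        jacobiTheta₂_term n (z + 1 / 2) τ) hs (fun n => (hC n).mul_const _)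
    (Eventually.of_forall fun N n => by
      rw [norm_mul]
      exact mul_le_mul_of_nonneg_right (hM N n) (norm_nonneg _))
  rw [tsum_mul_left] at this
  exact this.congr fun N => (hasSum_finite_tripleProduct hτ z N).tsum_eq

/-! ### Products of theta functions and the odd theta function. -/

/-- The decomposition of `ℤ × ℤ` into the pairs with even and with odd coordinate sum. -/
def intPairParityEquiv : (ℤ × ℤ) ⊕ (ℤ × ℤ) ≃ ℤ × ℤ where
  toFun := Sum.elim (fun p => (p.1 + p.2, p.1 - p.2)) (fun p => (p.1 + p.2 + 1, p.1 - p.2))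
  invFun p := if (p.1 + p.2) % 2 = 0 then Sum.inl ((p.1 + p.2) / 2, (p.1 - p.2) / 2)
    else Sum.inr ((p.1 + p.2 - 1) / 2, (p.1 - p.2 - 1) / 2)
  left_inv := by
    rintro (⟨s, t⟩ | ⟨s, t⟩)
    · have h : (s + t + (s - t)) % 2 = 0 := by omega
      simp only [Sum.elim_inl, h, if_true, Sum.inl.injEq, Prod.mk.injEq]
      omega
    · have h : ¬ (s + t + 1 + (s - t)) % 2 = 0 := by omega
      simp only [Sum.elim_inr, h, if_false, Sum.inr.injEq, Prod.mk.injEq]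
      omega
  right_inv := by
    rintro ⟨m, n⟩
    by_cases h : (m + n) % 2 = 0
    · simp only [h, if_true, Sum.elim_inl, Prod.mk.injEq]
      omega
    · simp only [h, if_false, Sum.elim_inr, Prod.mk.injEq]
      omega

lemma hasSum_mul_of_summable_norm {f g : ℤ → ℂ} {a b : ℂ} (hf : HasSum f a) (hg : HasSum g b)
    (hf' : Summable fun n => ‖f n‖) (hg' : Summable fun n => ‖g n‖) :
    HasSum (fun p : ℤ × ℤ => f p.1 * g p.2) (a * b) :=
  hf.mul hg (summable_mul_of_summable_norm hf' hg')

lemma hasSum_jacobiTheta₂_mul {τ : ℂ} (hτ : 0 < τ.im) (u v : ℂ) :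
    HasSum (fun p : ℤ × ℤ => jacobiTheta₂_term p.1 u τ * jacobiTheta₂_term p.2 v τ)
      (jacobiTheta₂ u τ * jacobiTheta₂ v τ) := by
  have h1 := hasSum_jacobiTheta₂_term u hτ
  have h2 := hasSum_jacobiTheta₂_term v hτ
  have h3 := ((summable_jacobiTheta₂_term_iff u τ).2 hτ).norm
  have h4 := ((summable_jacobiTheta₂_term_iff v τ).2 hτ).norm
  exact hasSum_mul_of_summable_norm (f := fun n => jacobiTheta₂_term n u τ)
    (g := fun n => jacobiTheta₂_term n v τ) h1 h2 h3 h4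

/-- The product of two theta functions in terms of theta functions of doubled modulus. -/
lemma jacobiTheta₂_mul {τ : ℂ} (hτ : 0 < τ.im) (u v : ℂ) :
    jacobiTheta₂ u τ * jacobiTheta₂ v τ =
      jacobiTheta₂ (u + v) (2 * τ) * jacobiTheta₂ (u - v) (2 * τ) +
      exp (Real.pi * I * (2 * u + τ)) *
        (jacobiTheta₂ (u + v + τ) (2 * τ) * jacobiTheta₂ (u - v + τ) (2 * τ)) := by
  have hτ2 : 0 < (2 * τ).im := by simpa using hτ
  -- In the new indices m² + n² becomes 2s² + 2t² on even pairs and 2s² + 2t² + 2s + 2t + 1 on odd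
  -- ones. The sums over s and t separate with modulus 2τ; in the odd case the linear terms shift
  -- both arguments by τ.
  have h := intPairParityEquiv.hasSum_iff.2 (hasSum_jacobiTheta₂_mul hτ u v)
  have h1 := hasSum_jacobiTheta₂_mul hτ2 (u + v) (u - v)
  have h2 := (hasSum_jacobiTheta₂_mul hτ2 (u + v + τ) (u - v + τ)).mul_left
    (exp (Real.pi * I * (2 * u + τ)))
  refine h.unique (HasSum.sum (f := _ ∘ intPairParityEquiv) ?_ ?_)
  · refine Eq.subst (motive := fun f => HasSum f _) ?_ h1
    funext ⟨s, t⟩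
    simp only [Function.comp_apply, intPairParityEquiv, Equiv.coe_fn_mk, Sum.elim_inl,
      jacobiTheta₂_term, ← exp_add]
    congr 1
    push_cast
    ring
  · refine Eq.subst (motive := fun f => HasSum f _) ?_ h2
    funext ⟨s, t⟩
    simp only [Function.comp_apply, intPairParityEquiv, Equiv.coe_fn_mk, Sum.elim_inr,
      jacobiTheta₂_term, ← exp_add]
    congr 1
    push_cast
    ring

/-- The odd theta function `exp (-πix) ϑ(x - τ/2 + 1/2, τ)`. -/
def oddTheta (τ x : ℂ) : ℂ := exp (-(Real.pi * I * x)) * jacobiTheta₂ (x - τ / 2 + 1 / 2) τ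

lemma oddTheta_neg (τ x : ℂ) : oddTheta τ (-x) = -oddTheta τ x := by
  rw [oddTheta, oddTheta, ← jacobiTheta₂_neg_left,
    show -(-x - τ / 2 + 1 / 2) = (x - τ / 2 - 1 / 2) + τ by ring, jacobiTheta₂_add_left',
    ← jacobiTheta₂_add_left (x - τ / 2 - 1 / 2),
    show x - τ / 2 - 1 / 2 + 1 = x - τ / 2 + 1 / 2 by ring, ← mul_assoc, ← exp_add,
    show -(Real.pi * I * -x) + -Real.pi * I * (τ + 2 * (x - τ / 2 - 1 / 2)) =
      Real.pi * I + -(Real.pi * I * x) by ring, exp_add, exp_pi_mul_I]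
  ring

lemma continuous_oddTheta {τ : ℂ} (hτ : 0 < τ.im) : Continuous (oddTheta τ) := by
  have h : Continuous fun x => jacobiTheta₂ x τ :=
    continuous_iff_continuousAt.2 fun x => (differentiableAt_jacobiTheta₂_fst x hτ).continuousAt
  unfold oddTheta
  exact (by fun_prop : Continuous fun x : ℂ => exp (-(Real.pi * I * x))).mul
    (h.comp (by fun_prop))

/-- Products of two values of the odd theta function are two by two determinants. -/
lemma exists_oddTheta_mul {τ : ℂ} (hτ : 0 < τ.im) : ∃ A B : ℂ → ℂ, ∀ x y,
    oddTheta τ (x + y) * oddTheta τ (x - y) = A x * B y - B x * A y := by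
  -- Up to a constant, these are the classical theta functions ϑ₂ and ϑ₃ of 2x with modulus 2τ; they
  -- come from the odd and the even part of `jacobiTheta₂_mul`.
  refine ⟨fun x => exp (2 * Real.pi * I * x) * jacobiTheta₂ (2 * x + τ) (2 * τ),
    fun x => jacobiTheta₂ (2 * x) (2 * τ), fun x y => ?_⟩
  have h := jacobiTheta₂_mul hτ (x + y - τ / 2 + 1 / 2) (x - y - τ / 2 + 1 / 2)
  rw [show x + y - τ / 2 + 1 / 2 + (x - y - τ / 2 + 1 / 2) + τ = 2 * x + 1 by ring,
    show x + y - τ / 2 + 1 / 2 + (x - y - τ / 2 + 1 / 2) = 2 * x - τ + 1 by ring,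
    show x + y - τ / 2 + 1 / 2 - (x - y - τ / 2 + 1 / 2) = 2 * y by ring,
    jacobiTheta₂_add_left, jacobiTheta₂_add_left] at h
  have h1 : jacobiTheta₂ (2 * x + τ) (2 * τ) =
      exp (-(4 * Real.pi * I * x)) * jacobiTheta₂ (2 * x - τ) (2 * τ) := by
    rw [show 2 * x + τ = 2 * x - τ + 2 * τ by ring, jacobiTheta₂_add_left']
    congr 2
    ring
  have h2 : exp (Real.pi * I * (2 * (x + y - τ / 2 + 1 / 2) + τ)) =
      -(exp (2 * Real.pi * I * x) * exp (2 * Real.pi * I * y)) := by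
    rw [← exp_add, ← neg_one_mul, ← exp_pi_mul_I, ← exp_add]
    congr 1
    ring
  have h3 : exp (-(Real.pi * I * (x + y))) * exp (-(Real.pi * I * (x - y))) =
      exp (-(2 * Real.pi * I * x)) := by
    rw [← exp_add]
    congr 1
    ring
  have h4 : exp (2 * Real.pi * I * x) * exp (-(4 * Real.pi * I * x)) =
      exp (-(2 * Real.pi * I * x)) := by
    rw [← exp_add]
    congr 1
    ring
  have h5 : exp (-(2 * Real.pi * I * x)) * exp (2 * Real.pi * I * x) = 1 := by
    rw [← exp_add, neg_add_cancel, exp_zero]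
  rw [h2] at h
  simp only [oddTheta, h1]
  generalize jacobiTheta₂ (2 * y + τ) (2 * τ) = Oy at *
  generalize jacobiTheta₂ (2 * y) (2 * τ) = Ey at *
  generalize jacobiTheta₂ (2 * x) (2 * τ) = Ex at *
  generalize jacobiTheta₂ (2 * x - τ) (2 * τ) = Ox at *
  linear_combination exp (-(Real.pi * I * (x + y))) * exp (-(Real.pi * I * (x - y))) * h +
    (Ox * Ey - exp (2 * Real.pi * I * x) * exp (2 * Real.pi * I * y) * Ex * Oy) * h3 -
    Ox * Ey * h4 - exp (2 * Real.pi * I * y) * Ex * Oy * h5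

/-! ### The algebraic kernel identity. -/

section OddFunction

variable {S A B : ℂ → ℂ} (hodd : ∀ x, S (-x) = -S x)
  (hS : ∀ x y, S (x + y) * S (x - y) = A x * B y - B x * A y)
include hodd hS

/-- The Plücker relation for the vectors (A, B) at the four points z + v, e, -u - y, y - u; oddness
matches the determinants with the stated products. -/
lemma three_term_identity (y z u v e : ℂ) :
    S (2 * y) * S (2 * u) * (A (z + v) * B e - B (z + v) * A e) =
      S (u - v - y - z) * S (y - z - u - v) * (A (-u - y) * B e - B (-u - y) * A e) -
      S (u - v + y - z) * S (-y - z - u - v) * (A (y - u) * B e - B (y - u) * A e) := by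
  have h1 : S (2 * y) * S (2 * u) = A (-u - y) * B (y - u) - B (-u - y) * A (y - u) := by
    rw [← hS, show -u - y + (y - u) = -(2 * u) by ring, show -u - y - (y - u) = -(2 * y) by ring,
      hodd, hodd]
    ring
  have h2 : S (u - v - y - z) * S (y - z - u - v) =
      A (z + v) * B (y - u) - B (z + v) * A (y - u) := by
    rw [← hS, show u - v - y - z = -(z + v + (y - u)) by ring,
      show y - z - u - v = -(z + v - (y - u)) by ring, hodd, hodd]
    ring
  have h3 : S (u - v + y - z) * S (-y - z - u - v) =
      A (z + v) * B (-u - y) - B (z + v) * A (-u - y) := by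
    rw [← hS, show u - v + y - z = -(z + v + (-u - y)) by ring,
      show -y - z - u - v = -(z + v - (-u - y)) by ring, hodd, hodd]
    ring
  rw [h1, h2, h3]
  ring

/-- The offsets are paired as u ± d and v ± e, so the pairs of factors are [z + u, d], [z + v, e]
and so on. After multiplication by S(2u) S(2z), the three-term identity at z and at -z expands the
e-brackets over [-u - y, e] and [y - u, e]. The d-brackets multiplying each of these two recombine
by one further Plücker relation, `p1` or `p2`. -/
lemma kernel_identity_of_ne_zero (y z u v d e : ℂ) (hu : S (2 * u) ≠ 0) (hz : S (2 * z) ≠ 0) :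
    S (2 * y) * (S (z + (u + d)) * S (z + (u - d)) * S (z + (v + e)) * S (z + (v - e)) *
          (S (z + y - u - v) * S (z - y - u - v)) -
        S (-z + (u + d)) * S (-z + (u - d)) * S (-z + (v + e)) * S (-z + (v - e)) *
          (S (-z + y - u - v) * S (-z - y - u - v))) =
      S (2 * z) * (S (-u - v - y + (u + d)) * S (-u - v - y + (u - d)) *
            S (-u - v - y + (v + e)) * S (-u - v - y + (v - e)) *
          (S (y + z - u - v) * S (y - z - u - v)) -
        S (-u - v + y + (u + d)) * S (-u - v + y + (u - d)) *
            S (-u - v + y + (v + e)) * S (-u - v + y + (v - e)) *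
          (S (-y + z - u - v) * S (-y - z - u - v))) := by
  have hp : ∀ p q x w, x + w = p → x - w = q → S p * S q = A x * B w - B x * A w := by
    rintro p q x w rfl rfl
    exact hS x w
  have a1 := hp (z + (u + d)) (z + (u - d)) (z + u) d (by ring) (by ring)
  have a2 := hp (z + (v + e)) (z + (v - e)) (z + v) e (by ring) (by ring)
  have b1 := hp (-z + (u + d)) (-z + (u - d)) (u - z) d (by ring) (by ring)
  have b2 := hp (-z + (v + e)) (-z + (v - e)) (-z + v) e (by ring) (by ring)
  have c1 := hp (-u - v - y + (u + d)) (-u - v - y + (u - d)) (-v - y) d (by ring) (by ring)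
  have c2 := hp (-u - v - y + (v + e)) (-u - v - y + (v - e)) (-u - y) e (by ring) (by ring)
  have d1 := hp (-u - v + y + (u + d)) (-u - v + y + (u - d)) (y - v) d (by ring) (by ring)
  have d2 := hp (-u - v + y + (v + e)) (-u - v + y + (v - e)) (y - u) e (by ring) (by ring)
  have e0 := hp (2 * u) (2 * z) (z + u) (u - z) (by ring) (by ring)
  have e1 := hp (u - v - y - z) (z - y - u - v) (-v - y) (u - z) (by ring) (by ring)
  have e2 := hp (u - v + y - z) (z + y - u - v) (y - v) (u - z) (by ring) (by ring)
  have e3 := hp (u - v - y + z) (-z - y - u - v) (-v - y) (z + u) (by ring) (by ring)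
  have e4 := hp (u - v + y + z) (-z + y - u - v) (y - v) (z + u) (by ring) (by ring)
  have t1 := three_term_identity hodd hS y z u v e
  have t2 := three_term_identity hodd hS y (-z) u v e
  rw [show u - v - y - -z = u - v - y + z by ring, show u - v + y - -z = u - v + y + z by ring,
    show y - -z - u - v = z + y - u - v by ring,
    show -y - -z - u - v = z - y - u - v by ring] at t2
  rw [show y - z - u - v = -z + y - u - v by ring,
    show -y - z - u - v = -z - y - u - v by ring] at t1
  rw [show y + z - u - v = z + y - u - v by ring, show y - z - u - v = -z + y - u - v by ring,
    show -y + z - u - v = z - y - u - v by ring, show -y - z - u - v = -z - y - u - v by ring]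
  have plucker : ∀ x1 x2 m1 m2 n1 n2 w1 w2 : ℂ, (m1 * n2 - m2 * n1) * (x1 * w2 - x2 * w1) =
      (x1 * n2 - x2 * n1) * (m1 * w2 - m2 * w1) - (x1 * m2 - x2 * m1) * (n1 * w2 - n2 * w1) := by
    intros
    ring
  have p1 := plucker (A (-v - y)) (B (-v - y)) (A (z + u)) (B (z + u)) (A (u - z)) (B (u - z))
    (A d) (B d)
  have p2 := plucker (A (y - v)) (B (y - v)) (A (z + u)) (B (z + u)) (A (u - z)) (B (u - z))
    (A d) (B d)
  rw [← e0, ← e1, ← e3, ← c1, ← a1, ← b1] at p1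
  rw [← e0, ← e2, ← e4, ← d1, ← a1, ← b1] at p2
  rw [← c2, ← d2, ← a2] at t1
  rw [← c2, ← d2, ← b2] at t2
  apply mul_left_cancel₀ (mul_ne_zero hu hz)
  generalize S (z + (u + d)) = x1 at *
  generalize S (z + (u - d)) = x2 at *
  generalize S (z + (v + e)) = x3 at *
  generalize S (z + (v - e)) = x4 at *
  generalize S (-z + (u + d)) = y1 at *
  generalize S (-z + (u - d)) = y2 at *
  generalize S (-z + (v + e)) = y3 at *
  generalize S (-z + (v - e)) = y4 at *
  generalize S (-u - v - y + (u + d)) = z1 at *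
  generalize S (-u - v - y + (u - d)) = z2 at *
  generalize S (-u - v - y + (v + e)) = z3 at *
  generalize S (-u - v - y + (v - e)) = z4 at *
  generalize S (-u - v + y + (u + d)) = w1 at *
  generalize S (-u - v + y + (u - d)) = w2 at *
  generalize S (-u - v + y + (v + e)) = w3 at *
  generalize S (-u - v + y + (v - e)) = w4 at *
  generalize S (z + y - u - v) = g1 at *
  generalize S (z - y - u - v) = g2 at *
  generalize S (-z + y - u - v) = g3 at *
  generalize S (-z - y - u - v) = g4 at *
  generalize S (2 * z) = sz at *
  generalize S (2 * y) = sy at *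
  generalize S (2 * u) = su at *
  linear_combination (x1 * x2 * sz * g1 * g2) * t1 - (y1 * y2 * sz * g3 * g4) * t2 -
    (sz * z3 * z4 * g1 * g3) * p1 + (sz * w3 * w4 * g2 * g4) * p2

lemma kernel_identity (hcont : Continuous S) (hdense : Dense {x | S x ≠ 0}) (y z g : ℂ)
    (t : Fin 4 → ℂ) (ht : ∑ n, t n + 2 * g = 0) (hz : S (2 * z) ≠ 0) :
    S (2 * y) * ((∏ n, S (z + t n)) * (S (z + y + g) * S (z - y + g)) -
        (∏ n, S (-z + t n)) * (S (-z + y + g) * S (-z - y + g))) =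
      S (2 * z) * ((∏ n, S (g - y + t n)) * (S (y + z + g) * S (y - z + g)) -
        (∏ n, S (g + y + t n)) * (S (-y + z + g) * S (-y - z + g))) := by
  simp only [Fin.sum_univ_four] at ht
  simp only [Fin.prod_univ_four]
  obtain ⟨u, hu⟩ : ∃ u, u = (t 0 + t 1) / 2 := ⟨_, rfl⟩
  obtain ⟨v, hv⟩ : ∃ v, v = (t 2 + t 3) / 2 := ⟨_, rfl⟩
  obtain ⟨d, hd⟩ : ∃ d, d = (t 0 - t 1) / 2 := ⟨_, rfl⟩
  obtain ⟨e, he⟩ : ∃ e, e = (t 2 - t 3) / 2 := ⟨_, rfl⟩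
  have h0 : t 0 = u + d := by rw [hu, hd]; ring
  have h1 : t 1 = u - d := by rw [hu, hd]; ring
  have h2 : t 2 = v + e := by rw [hv, he]; ring
  have h3 : t 3 = v - e := by rw [hv, he]; ring
  have hg : g = -u - v := by
    rw [h0, h1, h2, h3] at ht
    linear_combination ht / 2
  -- The condition S(2u) ≠ 0 is removed by continuity: u varies with d, e, g fixed, and v = -g - u
  -- follows it.
  have key : ∀ u' ∈ {x | S (2 * x) ≠ 0}, _ := fun u' hu' =>
    kernel_identity_of_ne_zero hodd hS y z u' (-g - u') d e hu' hz
  have hd : Dense {x | S (2 * x) ≠ 0} := by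
    have := hdense.preimage (Homeomorph.mulLeft₀ (2 : ℂ) two_ne_zero).isOpenMap
    exact this
  have := Continuous.ext_on hd (by fun_prop) (by fun_prop) key
  have := congrFun this u
  have hv' : -g - u = v := by rw [hg]; ring
  rw [hv'] at this
  rw [h0, h1, h2, h3, hg]
  convert this using 6 <;> ring_nf

end OddFunction

/-! ### Infinite products and the difference equation of the gamma function. -/

/-- The product `∏_{m ≥ 0} (1 - p^{2m+1} x)`. -/
def oddPoch (p x : ℂ) : ℂ := ∏' m : ℕ, (1 - p ^ (2 * m + 1) * x)

/-- The double product `∏_{m,n ≥ 0} (1 - p^{2m+1} r^{2n+1} x)`. -/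
def doublePoch (p r x : ℂ) : ℂ :=
  ∏' k : ℕ × ℕ, (1 - p ^ (2 * k.1 + 1) * r ^ (2 * k.2 + 1) * x)

lemma summable_norm_odd_pow {p : ℂ} (hp : ‖p‖ < 1) : Summable fun m : ℕ => ‖p ^ (2 * m + 1)‖ := by
  have h : Function.Injective fun m : ℕ => 2 * m + 1 := fun a b hab => by
    simp only at hab
    omega
  simpa only [norm_pow, Function.comp_def] using
    (summable_geometric_of_lt_one (norm_nonneg _) hp).comp_injective h

lemma summable_norm_oddPoch {p : ℂ} (hp : ‖p‖ < 1) (x : ℂ) :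
    Summable fun m : ℕ => ‖-(p ^ (2 * m + 1) * x)‖ := by
  simpa only [norm_neg, norm_mul] using (summable_norm_odd_pow hp).mul_right ‖x‖

lemma multipliable_oddPoch {p : ℂ} (hp : ‖p‖ < 1) (x : ℂ) :
    Multipliable fun m : ℕ => 1 - p ^ (2 * m + 1) * x := by
  simpa only [sub_eq_add_neg] using multipliable_one_add_of_summable (summable_norm_oddPoch hp x)

lemma summable_norm_doublePoch {p r : ℂ} (hp : ‖p‖ < 1) (hr : ‖r‖ < 1) (x : ℂ) :
    Summable fun k : ℕ × ℕ => ‖-(p ^ (2 * k.1 + 1) * r ^ (2 * k.2 + 1) * x)‖ := by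
  have h := (summable_norm_odd_pow hp).mul_of_nonneg (summable_norm_odd_pow hr)
    (fun _ => norm_nonneg _) (fun _ => norm_nonneg _)
  simpa only [norm_neg, norm_mul] using h.mul_right ‖x‖

lemma multipliable_doublePoch {p r : ℂ} (hp : ‖p‖ < 1) (hr : ‖r‖ < 1) (x : ℂ) :
    Multipliable fun k : ℕ × ℕ => 1 - p ^ (2 * k.1 + 1) * r ^ (2 * k.2 + 1) * x := by
  simpa only [sub_eq_add_neg] using
    multipliable_one_add_of_summable (summable_norm_doublePoch hp hr x)

lemma doublePoch_ne_zero {p r : ℂ} (hp : ‖p‖ < 1) (hr : ‖r‖ < 1) {x : ℂ}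
    (h : ∀ m n : ℕ, p ^ (2 * m + 1) * r ^ (2 * n + 1) * x ≠ 1) : doublePoch p r x ≠ 0 := by
  have := tprod_one_add_ne_zero_of_summable
    (f := fun k : ℕ × ℕ => -(p ^ (2 * k.1 + 1) * r ^ (2 * k.2 + 1) * x))
    (fun k => by
      rw [← sub_eq_add_neg]
      exact sub_ne_zero.2 (h k.1 k.2).symm) (summable_norm_doublePoch hp hr x)
  simp only [← sub_eq_add_neg] at this
  exact this

lemma doublePoch_comm (p r x : ℂ) : doublePoch p r x = doublePoch r p x := by
  rw [doublePoch, ← (Equiv.prodComm ℕ ℕ).tprod_eq]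
  simp only [doublePoch, Equiv.prodComm_apply, Prod.fst_swap, Prod.snd_swap, mul_comm (p ^ _)]

/-- The factors with n = 0 form the single product; replacing n by n + 1 in the others multiplies x
by r². -/
lemma doublePoch_shift {p r : ℂ} (hp : ‖p‖ < 1) (hr : ‖r‖ < 1) (x : ℂ) :
    doublePoch p r x = oddPoch p (r * x) * doublePoch p r (r ^ 2 * x) := by
  have hfib : ∀ y (m : ℕ), Multipliable fun n : ℕ => 1 - p ^ (2 * m + 1) * r ^ (2 * n + 1) * y :=
    fun y m => (multipliable_oddPoch hr (p ^ (2 * m + 1) * y)).congr fun n => by ring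
  have hdouble : ∀ y, HasProd (fun m : ℕ => ∏' n : ℕ, (1 - p ^ (2 * m + 1) * r ^ (2 * n + 1) * y))
      (doublePoch p r y) := fun y =>
    (multipliable_doublePoch hp hr y).hasProd.prod_fiberwise fun m => (hfib y m).hasProd
  have hin : ∀ m : ℕ, ∏' n : ℕ, (1 - p ^ (2 * m + 1) * r ^ (2 * n + 1) * x) =
      (1 - p ^ (2 * m + 1) * (r * x)) *
        ∏' n : ℕ, (1 - p ^ (2 * m + 1) * r ^ (2 * n + 1) * (r ^ 2 * x)) := fun m => by
    have h4 : ∀ n : ℕ, p ^ (2 * m + 1) * r ^ (2 * (n + 1) + 1) * x =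
        p ^ (2 * m + 1) * r ^ (2 * n + 1) * (r ^ 2 * x) := fun n => by ring
    have h5 : Multipliable fun n : ℕ => 1 - p ^ (2 * m + 1) * r ^ (2 * (n + 1) + 1) * x := by
      simp only [h4]
      exact hfib _ m
    have h6 := tprod_eq_zero_mul' (f := fun n : ℕ => 1 - p ^ (2 * m + 1) * r ^ (2 * n + 1) * x) h5
    simp only [h4] at h6
    rw [h6]
    congr 1
    ring
  have h1 := hdouble x
  rw [funext hin] at h1
  exact h1.unique ((multipliable_oddPoch hp (r * x)).hasProd.mul (hdouble (r ^ 2 * x)))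

variable {a : ℤˣ → ℂ} {δ : ℤˣ}

lemma norm_q_lt_one (h : 0 < (a δ).re) : ‖q a δ‖ < 1 := by
  rw [q, norm_exp]
  simp [Real.pi_pos, h]

lemma R_eq_mul (h : 0 < (a δ).re) (z : ℂ) :
    R a δ z = oddPoch (q a δ) (exp (2 * Real.pi * I * z)) *
      oddPoch (q a δ) (exp (-(2 * Real.pi * I * z))) :=
  (multipliable_oddPoch (norm_q_lt_one h) _).tprod_mul (multipliable_oddPoch (norm_q_lt_one h) _)

lemma R_neg (z : ℂ) : R a δ (-z) = R a δ z := by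
  simp only [R, mul_neg, neg_neg]
  exact tprod_congr fun k => mul_comm _ _

/-- Symmetry of the double product in the two nomes lets one argument serve both signs. -/
lemma ellGamma_eq (a : ℤˣ → ℂ) (δ : ℤˣ) (z : ℂ) :
    ellGamma a z = doublePoch (q a δ) (q a (-δ)) (exp (-(2 * Real.pi * I * z))) /
      doublePoch (q a δ) (q a (-δ)) (exp (2 * Real.pi * I * z)) := by
  rcases Int.units_eq_one_or δ with rfl | rfl
  · rfl
  · rw [doublePoch_comm, doublePoch_comm (q a (-1)), neg_neg]
    rfl

lemma doublePoch_ne_zero_of_not_isGammaPole (ha : ∀ δ, 0 < (a δ).re) (δ : ℤˣ) {z : ℂ}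
    (hz : ¬ IsGammaPole a z) :
    doublePoch (q a δ) (q a (-δ)) (exp (2 * Real.pi * I * z)) ≠ 0 := by
  have key : ∀ m n : ℕ,
      q a 1 ^ (2 * m + 1) * q a (-1) ^ (2 * n + 1) * exp (2 * Real.pi * I * z) ≠ 1 := by
    intro m n h
    rw [q, q, ← exp_nat_mul, ← exp_nat_mul, ← exp_add, ← exp_add, exp_eq_one_iff] at h
    obtain ⟨k, hk⟩ := h
    refine hz ⟨m, n, k, ?_⟩
    have h2 : (2 * Real.pi * I : ℂ) ≠ 0 := two_pi_I_ne_zero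
    apply mul_left_cancel₀ h2
    push_cast at hk
    linear_combination hk +
      (2 * Real.pi * ((m + 1 / 2) * a 1 + (n + 1 / 2) * a (-1))) * I_sq
  have h1 := doublePoch_ne_zero (norm_q_lt_one (ha 1)) (norm_q_lt_one (ha (-1))) key
  rcases Int.units_eq_one_or δ with rfl | rfl
  · exact h1
  · rw [doublePoch_comm, neg_neg]
    exact h1

/-- The first order difference equation of the elliptic gamma function. -/
lemma ellGamma_add (ha : ∀ δ, 0 < (a δ).re) (δ : ℤˣ) {u : ℂ}
    (hu : ¬ IsGammaPole a (u - I * a (-δ) / 2)) :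
    ellGamma a (u + I * a (-δ) / 2) = R a δ u * ellGamma a (u - I * a (-δ) / 2) := by
  have h0 := doublePoch_ne_zero_of_not_isGammaPole ha δ hu
  have hs := doublePoch_shift (norm_q_lt_one (ha δ)) (norm_q_lt_one (ha (-δ)))
  have e1 : ∀ w : ℂ, q a (-δ) * exp (2 * Real.pi * I * (w - I * a (-δ) / 2)) =
      exp (2 * Real.pi * I * w) := fun w => by
    rw [q, ← exp_add]
    congr 1
    linear_combination (-Real.pi * a (-δ)) * I_sq
  have e2 : ∀ w : ℂ, q a (-δ) ^ 2 * exp (2 * Real.pi * I * (w - I * a (-δ) / 2)) =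
      exp (2 * Real.pi * I * (w + I * a (-δ) / 2)) := fun w => by
    rw [q, ← exp_nat_mul, ← exp_add]
    congr 1
    push_cast
    linear_combination (-2 * Real.pi * a (-δ)) * I_sq
  -- `s1` splits the denominator at u - i a_{-δ}/2 and `s2` the numerator at u + i a_{-δ}/2; the two
  -- single products split off are the two halves of R_δ(u). Nonvanishing of the former denominator
  -- makes both of its factors cancellable.
  have s1 := hs (exp (2 * Real.pi * I * (u - I * a (-δ) / 2)))
  have s2 := hs (exp (2 * Real.pi * I * (-u - I * a (-δ) / 2)))
  rw [e1, e2] at s1 s2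
  rw [s1] at h0
  rw [ellGamma_eq a δ, ellGamma_eq a δ, R_eq_mul (ha δ), s1,
    show -(2 * Real.pi * I * (u + I * a (-δ) / 2)) = 2 * Real.pi * I * (-u - I * a (-δ) / 2) by ring,
    show -(2 * Real.pi * I * (u - I * a (-δ) / 2)) = 2 * Real.pi * I * (-u + I * a (-δ) / 2) by ring,
    show -(2 * Real.pi * I * u) = 2 * Real.pi * I * -u by ring, s2]
  have h1 := left_ne_zero_of_mul h0
  have h2 := right_ne_zero_of_mul h0
  field_simp

/-! ### The function R_δ as a theta function, its zeros and quasi-periodicity. -/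

lemma im_I_mul_pos (h : 0 < (a δ).re) : 0 < (I * a δ).im := by simpa using h

lemma exists_R_eq_oddTheta (h : 0 < (a δ).re) : ∃ C : ℂ, C ≠ 0 ∧ ∀ x,
    R a δ (x - I * a δ / 2) = C * (exp (Real.pi * I * x) * oddTheta (I * a δ) x) := by
  obtain ⟨C, hC, hlim⟩ := exists_tripleProduct (im_I_mul_pos h)
  refine ⟨C, hC, fun x => ?_⟩
  have hq : exp (Real.pi * I * (I * a δ)) = q a δ := by
    rw [q]
    congr 1
    linear_combination Real.pi * a δ * I_sq
  have h1 := hlim (x - I * a δ / 2)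
  rw [hq] at h1
  have h2 := ((multipliable_oddPoch (norm_q_lt_one h) (exp (2 * Real.pi * I * (x - I * a δ / 2)))).mul
    (multipliable_oddPoch (norm_q_lt_one h)
      (exp (-(2 * Real.pi * I * (x - I * a δ / 2)))))).hasProd.tendsto_prod_nat
  rw [oddTheta, ← mul_assoc (exp _), ← exp_add, add_neg_cancel, exp_zero, one_mul]
  exact tendsto_nhds_unique h2 h1

lemma oddPoch_ne_zero {p : ℂ} (hp : ‖p‖ < 1) {x : ℂ} (h : ∀ m : ℕ, p ^ (2 * m + 1) * x ≠ 1) :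
    oddPoch p x ≠ 0 := by
  have := tprod_one_add_ne_zero_of_summable (f := fun m : ℕ => -(p ^ (2 * m + 1) * x))
    (fun m => by
      rw [← sub_eq_add_neg]
      exact sub_ne_zero.2 (h m).symm) (summable_norm_oddPoch hp x)
  simp only [← sub_eq_add_neg] at this
  exact this

lemma R_ne_zero (h : 0 < (a δ).re) {x : ℂ} (hx : x ∉ lattice a δ) :
    R a δ (x - I * a δ / 2) ≠ 0 := by
  rw [R_eq_mul h]
  refine mul_ne_zero (oddPoch_ne_zero (norm_q_lt_one h) fun m hm => hx ?_)
    (oddPoch_ne_zero (norm_q_lt_one h) fun m hm => hx ?_)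
  all_goals
    rw [q, ← exp_nat_mul, ← exp_add, exp_eq_one_iff] at hm
    obtain ⟨k, hk⟩ := hm
    have h2 : (2 * Real.pi * I : ℂ) ≠ 0 := two_pi_I_ne_zero
    push_cast at hk
  · refine ⟨k, -m, mul_left_cancel₀ h2 ?_⟩
    push_cast
    linear_combination hk + Real.pi * a δ * (2 * m + 1) * I_sq
  · refine ⟨-k, m + 1, mul_left_cancel₀ h2 ?_⟩
    push_cast
    linear_combination -hk + (-Real.pi * a δ * (2 * m + 1)) * I_sq

lemma countable_lattice : (lattice a δ).Countable := by
  refine (Set.countable_range fun p : ℤ × ℤ => (p.1 + p.2 * (I * a δ) : ℂ)).mono ?_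
  rintro _ ⟨m, n, rfl⟩
  exact ⟨(m, n), rfl⟩

lemma oddTheta_ne_zero (h : 0 < (a δ).re) {x : ℂ} (hx : x ∉ lattice a δ) :
    oddTheta (I * a δ) x ≠ 0 := by
  obtain ⟨C, -, hR⟩ := exists_R_eq_oddTheta h
  have := R_ne_zero h hx
  rw [hR] at this
  exact right_ne_zero_of_mul (right_ne_zero_of_mul this)

lemma dense_oddTheta_ne_zero (h : 0 < (a δ).re) : Dense {x | oddTheta (I * a δ) x ≠ 0} :=
  (countable_lattice.dense_compl ℝ).mono fun _ hx => oddTheta_ne_zero h hx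

lemma jacobiTheta₂_sub_int (z τ : ℂ) (m : ℤ) : jacobiTheta₂ (z - m) τ = jacobiTheta₂ z τ := by
  have h : Function.Periodic (fun z => jacobiTheta₂ z τ) 1 := fun z => jacobiTheta₂_add_left z τ
  simpa using h.sub_zsmul_eq (x := z) m

/-- This allows one offset in `coeff_identity` to be moved by the lattice vector 2τ - m at the cost
of an exponential. -/
lemma exp_mul_oddTheta_shift (τ x : ℂ) (m : ℤ) :
    exp (Real.pi * I * (x + 2 * τ - m)) * oddTheta τ (x + 2 * τ - m) =
      exp (-(Real.pi * I * (3 * x + 2 * τ))) * oddTheta τ x := by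
  rw [oddTheta, oddTheta, ← mul_assoc, ← exp_add, add_neg_cancel, exp_zero, one_mul,
    show x + 2 * τ - m - τ / 2 + 1 / 2 = x - τ / 2 + 1 / 2 + τ + τ - m by ring,
    jacobiTheta₂_sub_int, jacobiTheta₂_add_left', jacobiTheta₂_add_left', ← mul_assoc, ← mul_assoc,
    ← exp_add, ← exp_add]
  congr 1
  rw [exp_eq_exp_iff_exists_int]
  refine ⟨-1, ?_⟩
  push_cast
  ring

lemma halfSum_eq (a : ℤˣ → ℂ) (δ : ℤˣ) : halfSum a = (a δ + a (-δ)) / 2 := by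
  rcases Int.units_eq_one_or δ with rfl | rfl
  · rfl
  · rw [halfSum, neg_neg, add_comm]

/-! ### Reduction of the coefficient identity to theta functions. -/

/-- The identity relating the coefficients of the two difference operators. -/
lemma coeff_identity (ha : ∀ δ, 0 < (a δ).re) (γ : ℂ) (l : Fin 4 → ℂ)
    (hγ : exp (4 * Real.pi * I * γ) = exp (2 * Real.pi * I * ((∑ n, l n) + 2 * I * halfSum a)))
    (δ : ℤˣ) (z y : ℂ) (hz : 2 * z ∉ lattice a δ) (hy : 2 * y ∉ lattice a δ) :
    coeff a δ l z * (R a δ (z + y - γ) * R a δ (z - y - γ)) +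
        coeff a δ l (-z) * (R a δ (-z + y - γ) * R a δ (-z - y - γ)) =
      coeff a δ (fun n => -l n + γ - I * halfSum a) y *
          (R a δ (z + y - γ) * R a δ (-z + y - γ)) +
        coeff a δ (fun n => -l n + γ - I * halfSum a) (-y) *
          (R a δ (z - y - γ) * R a δ (-z - y - γ)) := by
  obtain ⟨C, hC, hR⟩ := exists_R_eq_oddTheta (ha δ)
  obtain ⟨A, B, hAB⟩ := exists_oddTheta_mul (im_I_mul_pos (ha δ))
  obtain ⟨m, hm⟩ := exp_eq_exp_iff_exists_int.1 hγ
  have hm' : 2 * γ = ∑ n, l n + I * a δ + I * a (-δ) + m := by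
    apply mul_left_cancel₀ two_pi_I_ne_zero
    rw [halfSum_eq a δ] at hm
    linear_combination hm
  have hodd := oddTheta_neg (I * a δ)
  have hz0 := oddTheta_ne_zero (ha δ) hz
  have hy0 := oddTheta_ne_zero (ha δ) hy
  have hcont := continuous_oddTheta (im_I_mul_pos (ha δ))
  have hdense := dense_oddTheta_ne_zero (ha δ)
  have hshift := exp_mul_oddTheta_shift (I * a δ)
  set S := oddTheta (I * a δ)
  set τ := I * a δ with hτ
  obtain ⟨g, hg⟩ : ∃ g, g = -γ + τ / 2 := ⟨_, rfl⟩
  -- The unshifted offsets l n + i a_{-δ}/4 + τ/2 together with 2g sum to 2τ - m by `hm'`.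
  -- Subtracting this from the first one gives the balance required by `kernel_identity`.
  obtain ⟨t, ht⟩ : ∃ t : Fin 4 → ℂ, t = ![l 0 + I * a (-δ) / 4 + τ / 2 - (2 * τ - m),
    l 1 + I * a (-δ) / 4 + τ / 2, l 2 + I * a (-δ) / 4 + τ / 2,
    l 3 + I * a (-δ) / 4 + τ / 2] := ⟨_, rfl⟩
  have ht0 : t 0 = l 0 + I * a (-δ) / 4 + τ / 2 - (2 * τ - m) := by rw [ht]; rfl
  have ht1 : t 1 = l 1 + I * a (-δ) / 4 + τ / 2 := by rw [ht]; rfl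
  have ht2 : t 2 = l 2 + I * a (-δ) / 4 + τ / 2 := by rw [ht]; rfl
  have ht3 : t 3 = l 3 + I * a (-δ) / 4 + τ / 2 := by rw [ht]; rfl
  have hsum : ∑ n, t n + 2 * g = 0 := by
    rw [Fin.sum_univ_four] at hm' ⊢
    rw [ht0, ht1, ht2, ht3, hg]
    linear_combination -hm'
  -- The four exponentials from the numerator multiply to κ: the quasi-period factor contributes
  -- -3w, which cancels the 3w of the other three, and the balance condition eliminates t 1 + t 2 +
  -- t 3. Independence of w makes κ common to all terms.
  obtain ⟨κ, hκ⟩ : ∃ κ, κ = exp (Real.pi * I * (-4 * t 0 - 2 * τ - 2 * g)) := ⟨_, rfl⟩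
  have hnum : ∀ w, ∏ n, R a δ (w + l n + I * a (-δ) / 4) = C ^ 4 * κ * ∏ n, S (w + t n) := by
    intro w
    have h0 : R a δ (w + l 0 + I * a (-δ) / 4) =
        C * (exp (-(Real.pi * I * (3 * (w + t 0) + 2 * τ))) * S (w + t 0)) := by
      rw [← hshift _ m, ← hR]
      congr 1
      rw [ht0]
      ring
    have h' : ∀ n, t n = l n + I * a (-δ) / 4 + τ / 2 → R a δ (w + l n + I * a (-δ) / 4) =
        C * (exp (Real.pi * I * (w + t n)) * S (w + t n)) := by
      intro n hn
      rw [← hR]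
      congr 1
      rw [hn]
      ring
    have hexp : exp (-(Real.pi * I * (3 * (w + t 0) + 2 * τ))) * exp (Real.pi * I * (w + t 1)) *
        exp (Real.pi * I * (w + t 2)) * exp (Real.pi * I * (w + t 3)) = κ := by
      rw [hκ, ← exp_add, ← exp_add, ← exp_add]
      congr 1
      rw [Fin.sum_univ_four] at hsum
      linear_combination Real.pi * I * hsum
    rw [Fin.prod_univ_four, Fin.prod_univ_four, h0, h' 1 ht1, h' 2 ht2, h' 3 ht3, ← hexp]
    ring
  have hden : ∀ w x, R a δ (w + x - γ) * R a δ (w - x - γ) / R a δ (2 * w - τ / 2) =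
      C * exp (2 * Real.pi * I * g) * (S (w + x + g) * S (w - x + g) / S (2 * w)) := by
    intro w x
    have h1 : R a δ (w + x - γ) = C * (exp (Real.pi * I * (w + x + g)) * S (w + x + g)) := by
      rw [← hR]
      congr 1
      rw [hg]
      ring
    have h2 : R a δ (w - x - γ) = C * (exp (Real.pi * I * (w - x + g)) * S (w - x + g)) := by
      rw [← hR]
      congr 1
      rw [hg]
      ring
    have h3 : exp (Real.pi * I * (w + x + g)) * exp (Real.pi * I * (w - x + g)) =
        exp (2 * Real.pi * I * g) * exp (Real.pi * I * (2 * w)) := by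
      rw [← exp_add, ← exp_add]
      congr 1
      ring
    have h4 := exp_ne_zero (Real.pi * I * (2 * w))
    rw [h1, h2, hR, show ∀ e1 e2 s1 s2 : ℂ, C * (e1 * s1) * (C * (e2 * s2)) =
      C * C * (e1 * e2) * (s1 * s2) by intros; ring, h3]
    rw [show C * C * (exp (2 * Real.pi * I * g) * exp (Real.pi * I * (2 * w))) =
      C * exp (2 * Real.pi * I * g) * (C * exp (Real.pi * I * (2 * w))) by ring,
      ← mul_assoc C (exp (Real.pi * I * (2 * w))), mul_assoc (C * exp (2 * Real.pi * I * g)),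
      mul_div_assoc, mul_div_mul_left _ _ (mul_ne_zero hC h4)]
  -- Evenness of R_δ reflects each argument, and the choice of k turns it into g - w + l n + i
  -- a_{-δ}/4: the dual numerator is the original one at g - w.
  have hdual : ∀ w, ∏ n, R a δ (w + (-l n + γ - I * halfSum a) + I * a (-δ) / 4) =
      C ^ 4 * κ * ∏ n, S (g - w + t n) := by
    intro w
    rw [← hnum]
    refine prod_congr rfl fun n _ => ?_
    rw [← R_neg, halfSum_eq a δ]
    congr 1
    rw [hg, hτ]
    ring
  have key := kernel_identity hodd hAB hcont hdense y z g t hsum hz0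
  have hterm : ∀ N D P : ℂ, N / D * P = N * (P / D) := fun N D P => by ring
  simp only [coeff, ← hτ]
  rw [hterm, hterm, hterm, hterm, hden, hden, hnum, hnum, hdual, hdual,
    show z + y - γ = y + z - γ by ring, show -z + y - γ = y - z - γ by ring,
    show z - y - γ = -y + z - γ by ring, show -z - y - γ = -y - z - γ by ring, hden, hden,
    show 2 * -z = -(2 * z) by ring, show 2 * -y = -(2 * y) by ring, hodd (2 * z), hodd (2 * y),
    show g - -y = g + y by ring]
  have h1 : ∀ p1 p2 p3 p4 q1 q2 q3 q4 s1 s2 : ℂ, s1 ≠ 0 → s2 ≠ 0 →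
      s2 * (p1 * q1 - p2 * q2) = s1 * (p3 * q3 - p4 * q4) →
      C ^ 4 * κ * p1 * (C * exp (2 * Real.pi * I * g) * (q1 / s1)) +
        C ^ 4 * κ * p2 * (C * exp (2 * Real.pi * I * g) * (q2 / -s1)) =
      C ^ 4 * κ * p3 * (C * exp (2 * Real.pi * I * g) * (q3 / s2)) +
        C ^ 4 * κ * p4 * (C * exp (2 * Real.pi * I * g) * (q4 / -s2)) := by
    intro p1 p2 p3 p4 q1 q2 q3 q4 s1 s2 hs1 hs2 h
    rw [div_neg, div_neg]
    field_simp
    linear_combination κ * h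
  exact h1 _ _ _ _ _ _ _ _ _ _ hz0 hy0 key

end Sklyanin

end

/-! ### The kernel identity for the difference operators. -/

/-- The identity of meromorphic functions `A_{R,δ}(l;z) K = A_{R,δ}(k;y) K`, at every `(z,y)`
where no factor of either side has a pole. -/
theorem theorem4p1 (a : ℤˣ → ℂ) (ha : ∀ δ, 0 < (a δ).re) (γ : ℂ) (l : Fin 4 → ℂ)
    (hγ : Complex.exp (4 * Real.pi * Complex.I * γ) =
      Complex.exp (2 * Real.pi * Complex.I *
        ((∑ n, l n) + 2 * Complex.I * Sklyanin.halfSum a))) :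
    ∀ (δ : ℤˣ) (z y : ℂ),
      2 * z ∉ Sklyanin.lattice a δ → 2 * y ∉ Sklyanin.lattice a δ →
      Sklyanin.KernelRegular a γ (z + Complex.I * a (-δ) / 2) y →
      Sklyanin.KernelRegular a γ (z - Complex.I * a (-δ) / 2) y →
      Sklyanin.KernelRegular a γ z (y + Complex.I * a (-δ) / 2) →
      Sklyanin.KernelRegular a γ z (y - Complex.I * a (-δ) / 2) →
      Sklyanin.opAR a δ l (fun z' => Sklyanin.kernelK a γ z' y) z =
        Sklyanin.opAR a δ (fun n => -l n + γ - Complex.I * Sklyanin.halfSum a)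
          (fun y' => Sklyanin.kernelK a γ z y') y := by
  intro δ z y hz hy h1 h2 _ _
  have key := Sklyanin.coeff_identity ha γ l hγ δ z y hz hy
  obtain ⟨-, -, h13, h14⟩ := h1
  obtain ⟨h21, h22, -, -⟩ := h2
  set b := Complex.I * a (-δ) / 2 with hb
  rw [show -(z + b) + y - γ = -z + y - γ - b by ring] at h13
  rw [show -(z + b) - y - γ = -z - y - γ - b by ring] at h14
  rw [show z - b + y - γ = z + y - γ - b by ring] at h21
  rw [show z - b - y - γ = z - y - γ - b by ring] at h22
  -- Every raised gamma factor is rewritten through its lowered counterpart, so that the four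
  -- lowered factors become common to all terms.
  have g1 := Sklyanin.ellGamma_add ha δ h21
  have g2 := Sklyanin.ellGamma_add ha δ h22
  have g3 := Sklyanin.ellGamma_add ha δ h13
  have g4 := Sklyanin.ellGamma_add ha δ h14
  simp only [← hb] at g1 g2 g3 g4
  simp only [Sklyanin.opAR, Sklyanin.kernelK, ← hb]
  rw [show z + b + y - γ = z + y - γ + b by ring, show z + b - y - γ = z - y - γ + b by ring,
    show -(z + b) + y - γ = -z + y - γ - b by ring, show -(z + b) - y - γ = -z - y - γ - b by ring,
    show z - b + y - γ = z + y - γ - b by ring, show z - b - y - γ = z - y - γ - b by ring,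
    show -(z - b) + y - γ = -z + y - γ + b by ring, show -(z - b) - y - γ = -z - y - γ + b by ring,
    show z + (y + b) - γ = z + y - γ + b by ring, show z - (y + b) - γ = z - y - γ - b by ring,
    show -z + (y + b) - γ = -z + y - γ + b by ring, show -z - (y + b) - γ = -z - y - γ - b by ring,
    show z + (y - b) - γ = z + y - γ - b by ring, show z - (y - b) - γ = z - y - γ + b by ring,
    show -z + (y - b) - γ = -z + y - γ - b by ring, show -z - (y - b) - γ = -z - y - γ + b by ring,
    g1, g2, g3, g4]
  linear_combination (Sklyanin.ellGamma a (z + y - γ - b) * Sklyanin.ellGamma a (z - y - γ - b) *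
    Sklyanin.ellGamma a (-z + y - γ - b) * Sklyanin.ellGamma a (-z - y - γ - b)) * key
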